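/- **Model.** An anonymous quantum network with $n$ parties is a connected simple undirected graph on the parties together with a port numbering: each party $v$, of degree $d_v$, labels its incident links bijectively by $d_v$ port labels, independently of the other parties. Communication is synchronous and faultless. All parties run the same algorithm: the operation of a party at time $t$ depends only on $t$, on $n$ (which is given to every party) and on the number $d$ of its own ports; the topology is unknown. Each party holds an input qubit $\mathsf{x}$, an output qubit $\mathsf{y}$ initialized to $|\mathrm{true}\rangle$, a finite-dimensional workspace in a fixed initial state, and one message register per port, whose basis states are the bit strings of bounded length and which is initially empty (the empty string means that nothing is sent). An algorithm without intermediate measurements consists of a number $T(n)$ of rounds and of local unitary operators: in each round every party applies its operator and then the message registers at the two ends of every link exchange their contents; after the last round every party applies one final operator. The round complexity is $T(n)$. In a run from a given initial state, the number of qubits sent through a port in a round is the maximal length of a message that occurs there with nonzero amplitude; the bit complexity of the run is the sum of these numbers over all parties, ports and rounds. For $k\ge 0$ let $H_k(x)=\mathrm{true}$ iff the Hamming weight of $x\in\{0,1\}^n$ is $k$. An algorithm without intermediate measurements exactly computes $H_k$ on a network if for every $x\in\{0,1\}^n$ it maps $\bigotimes_v |x_v\rangle|\mathrm{true}\rangle$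 (with initialized workspaces and empty message registers) to $\bigotimes_v |x_v\rangle|H_k(x)\rangle\otimes|g_x\rangle$ for some garbage state $|g_x\rangle$. For such an algorithm $\mathcal H$ and a network $N$ let $Q^{\mathrm{rnd}}(\mathcal H)$ be its number of rounds and let $Q_N^{\mathrm{bit}}(\mathcal H)$ be the supremum of its bit complexity on $N$ over all input states $\sum_x \alpha_x |x\rangle$ with $\sum_x|\alpha_x|^2=1$. **Theorem.** There is a universal constant $C$ such that for all algorithms $\mathcal H_0$ and $\mathcal H_1$ without intermediate measurements there is a quantum algorithm $\mathcal B$ with the following property. For every $n$ and every $n$-party anonymous network $N$ on which $\mathcal H_0$ exactly computes $H_0$ and $\mathcal H_1$ exactly computes $H_1$ (in particular for every network of any topology, if $\mathcal H_0$ and $\mathcal H_1$ are exact on all networks), $\mathcal B$ exactly elects a leader on $N$, that is, started without any input and with $\mathsf{y}=\mathrm{true}$ at every party, and measured at the end in the computational basis, it yields with certainty an outcome in which $\mathsf{y}=\mathrm{true}$ at exactly one party; it does so in at most $$C\,\bigl(Q^{\mathrm{rnd}}(\mathcal H_0)+Q^{\mathrm{rnd}}(\mathcal H_1)\bigr)$$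 rounds and with bit complexity at most $$C\,\bigl(Q_N^{\mathrm{bit}}(\mathcal H_0)+Q_N^{\mathrm{bit}}(\mathcal H_1)\bigr).$$ -/

import Mathlib

open scoped BigOperators

noncomputable section

namespace AnonymousQuantumNetwork

/-- An anonymous network of `n` parties: a connected simple graph (no self-loops, no multiple edges)
on the parties, together with a port numbering: for every party `v` a bijection from the links
incident to `v` (identified with the neighbours of `v`) to the port labels.  The existence of the
bijection `port v` forces `deg v` to be the degree of `v`.  The numberings at distinct parties are
unrelated. -/
structure Network (n : ℕ) where
  graph : SimpleGraph (Fin n)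
  connected : graph.Connected
  deg : Fin n → ℕ
  port : ∀ v, graph.neighborSet v ≃ Fin (deg v)

namespace Network

variable {n : ℕ} (N : Network n)

/-- The party at the other end of the link attached to port `p` of party `v`. -/
def nbr (v : Fin n) (p : Fin (N.deg v)) : Fin n := ((N.port v).symm p : Fin n)

/-- The label which that link has at the party at its other end. -/
def backPort (v : Fin n) (p : Fin (N.deg v)) : Fin (N.deg (N.nbr v p)) :=
  N.port (N.nbr v p) ⟨v, ((N.port v).symm p).2.symm⟩

end Network

/-- Basis states of a message register: bit strings of length at most `L`.
The empty string means that nothing is sent. -/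
abbrev Msg (L : ℕ) : Type := Σ k : Fin (L + 1), (Fin k → Bool)

instance (L : ℕ) : DecidableEq (Msg L) := inferInstance

/-- The number of (qu)bits of a message. -/
def Msg.length {L : ℕ} (m : Msg L) : ℕ := m.1

/-- The empty message. -/
def Msg.blank {L : ℕ} : Msg L := ⟨0, fun _ => false⟩

/-- The computational basis of the registers of a party with `d` ports: a qubit `x` (input),
a qubit `y` (output), a workspace with basis `W`, and one message register for each port. -/
abbrev Loc (W : Type) (L d : ℕ) : Type := Bool × Bool × W × (Fin d → Msg L)

/-- A quantum algorithm without intermediate measurements for synchronous anonymous networks.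
All parties run the same algorithm: what a party does depends only on the number `n` of parties
(which is given to every party), on the number `d` of its own ports and on the current time `t`.
The algorithm has `rounds n` rounds of communication.  In round `t` each party applies the unitary
operator `op n t d` to its own registers, and then the contents of the message registers are
sent through the ports, so that each party finds in the message register of a port what arrived
through that port.  After the last round each party applies a final operator
`op n (rounds n) d`. -/
structure QAlgorithm where
  rounds : ℕ → ℕ
  msgLen : ℕ → ℕ
  Work : ℕ → ℕ → Type
  [workFintype : ∀ n d, Fintype (Work n d)]
  [workDecEq : ∀ n d, DecidableEq (Work n d)]
  workInit : ∀ n d, Work n d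
  op : ∀ n (_t : ℕ) d, Matrix.unitaryGroup (Loc (Work n d) (msgLen n) d) ℂ

attribute [instance] QAlgorithm.workFintype QAlgorithm.workDecEq

namespace QAlgorithm

variable (A : QAlgorithm) {n : ℕ} (N : Network n)

/-- The computational basis of the whole network. -/
abbrev Config : Type := ∀ v : Fin n, Loc (A.Work n (N.deg v)) (A.msgLen n) (N.deg v)

/-- (Not necessarily normalized) pure states of the whole network, as families of amplitudes. -/
abbrev State : Type := A.Config N → ℂ

variable {N}

/-- Input bit of party `v` in a basis state. -/
def inBit (c : A.Config N) (v : Fin n) : Bool := (c v).1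

/-- Output bit of party `v` in a basis state. -/
def outBit (c : A.Config N) (v : Fin n) : Bool := (c v).2.1

/-- Content of the message register of port `p` of party `v` in a basis state. -/
def msg (c : A.Config N) (v : Fin n) (p : Fin (N.deg v)) : Msg (A.msgLen n) := (c v).2.2.2 p

/-- The effect of the message transmission on basis states: along every link, the two message
registers at its ends exchange their contents. -/
def exchange (c : A.Config N) : A.Config N := fun v =>
  ((c v).1, (c v).2.1, (c v).2.2.1, fun p => A.msg c (N.nbr v p) (N.backPort v p))

/-- All parties simultaneously apply their operators of time `t`: the tensor product
of the local unitaries acts on the global state. -/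
def localStep (t : ℕ) (ψ : A.State N) : A.State N := fun c =>
  ∑ c' : A.Config N,
    (∏ v, (A.op n t (N.deg v) : Matrix _ _ ℂ) (c v) (c' v)) * ψ c'

/-- Linear extension of `exchange`, which is an involution. -/
def exchangeStep (ψ : A.State N) : A.State N := fun c => ψ (A.exchange c)

/-- The global state after `t` rounds. -/
def stateAfter (ψ : A.State N) : ℕ → A.State N
  | 0 => ψ
  | t + 1 => A.exchangeStep (A.localStep t (stateAfter ψ t))

/-- The global state at the end of the algorithm. -/
def finalState (ψ : A.State N) : A.State N :=
  A.localStep (A.rounds n) (A.stateAfter ψ (A.rounds n))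

/-- The number of qubits sent by party `v` through port `p` in round `t`, when the
algorithm is started in the state `ψ`: the largest length of a message that occurs there
with nonzero amplitude just before the transmission. -/
def sentBits (ψ : A.State N) (t : ℕ) (v : Fin n) (p : Fin (N.deg v)) : ℕ := by
  classical
  exact (Finset.univ.filter fun c : A.Config N => A.localStep t (A.stateAfter ψ t) c ≠ 0).sup
    fun c => (A.msg c v p).length

/-- The number of qubits sent in total, over all links and in all rounds, when the
algorithm is started in the state `ψ`. -/
def bits (ψ : A.State N) : ℕ :=
  ∑ t ∈ Finset.range (A.rounds n), ∑ v, ∑ p, A.sentBits ψ t v p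

/-- The initial state on the input `∑ₓ α x |x⟩`: the input qubits of the parties are
in this state, every output qubit is `true`, the workspaces are in their initial states, and the
message registers are empty. -/
def inputState (α : (Fin n → Bool) → ℂ) : A.State N := by
  classical
  exact fun c =>
    if ∀ v, (c v).2 = (true, A.workInit n (N.deg v), fun _ => Msg.blank) then α (A.inBit c) else 0

/-- The initial state on a classical input `x`. -/
def classicalInput (x : Fin n → Bool) : A.State N := A.inputState (Pi.single x 1)

variable (N)

/-- The algorithm is an `f`-algorithm on the network `N`: it maps
`⊗ᵥ |x v⟩|true⟩ ⊗ |init⟩` to `⊗ᵥ |x v⟩|f x⟩ ⊗ |g x⟩` with arbitrary garbage `g x`, for every `x`. -/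
def ExactlyComputes (f : (Fin n → Bool) → Bool) : Prop :=
  ∀ (x : Fin n → Bool) (c : A.Config N), A.finalState (A.classicalInput x) c ≠ 0 →
    ∀ v, A.inBit c v = x v ∧ A.outBit c v = f x

/-- The algorithm exactly elects a leader on the network `N`: when it is started with
all `x` registers set to `false` (no party has an input) and all `y` registers set to `true`, then the
measurement of the final state in the computational basis yields with certainty an outcome
in which `y` is `true` at exactly one party. -/
def ExactlyElectsLeader : Prop :=
  ∀ c : A.Config N, A.finalState (A.classicalInput fun _ => false) c ≠ 0 →
    ∃! v, A.outBit c v = true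

/-- The number of qubits sent when the algorithm is run without input. -/
def bitsNoInput : ℕ := A.bits (A.classicalInput (N := N) fun _ => false)

/-- Worst-case bit complexity on the network `N`, over all quantum states as input. -/
def worstCaseBits : ℕ∞ :=
  ⨆ (α : (Fin n → Bool) → ℂ) (_ : ∑ x, ‖α x‖ ^ 2 = 1), (A.bits (A.inputState (N := N) α) : ℕ∞)

end QAlgorithm

/-- The symmetric function that is `true` iff the Hamming weight of the argument is `k`. -/
def hammingFn {n : ℕ} (k : ℕ) (x : Fin n → Bool) : Bool :=
  decide ((Finset.univ.filter fun v => x v = true).card = k)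

end AnonymousQuantumNetwork

end

noncomputable section

namespace AnonymousQuantumNetwork

set_option linter.unusedSectionVars false

/-! ### Links as an involution on ports -/

namespace Network

variable {n : ℕ} (N : Network n)

/-! The proof is one exact step of amplitude amplification. Every party rotates its input qubit by
the same real rotation `R`, tuned so that Hamming weight one has probability exactly 1/4. Let `e` be
the all-false state, `a = R^{⊗n} e`, and `b` the weight-one part of `a`. Flipping the sign of weight
one gives `a - 2b`, and undoing the rotation gives `e - 2 R⁻¹b`. The `e`-coordinate of `R⁻¹b` is
`⟨a, b⟩ = 1/4`, so that of `e - 2 R⁻¹b` is 1/2. Flipping the sign of this one coordinate makes it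
-1/2, which leaves exactly `-2 R⁻¹b`. A last rotation yields `-2b`, supported on weight one
(`amplification`), and each party copies its bit to its output.

The two sign flips come from `H₁` and `H₀`. Run the algorithm, let every party whose output is true
apply a phase `z` with `z ^ n = -1`, and run the algorithm backwards. All outputs agree, so the
total phase is -1 or 1 according to the function value, and reversal erases the garbage
(`QAlgorithm.final_flip`). The reversed run transmits as many qubits as the forward run from the
flipped state (`Prog.cost_conj`). Each algorithm is thus run once in each direction, which gives the
constant 2 for both rounds and bits. -/

theorem nbr_nbr (v : Fin n) (p : Fin (N.deg v)) : N.nbr (N.nbr v p) (N.backPort v p) = v :=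
  congrArg Subtype.val ((N.port (N.nbr v p)).symm_apply_apply _)

/-- The end of a link opposite to a given one, ends of links being identified with ports. -/
def opposite (q : Σ v, Fin (N.deg v)) : Σ v, Fin (N.deg v) := ⟨N.nbr q.1 q.2, N.backPort q.1 q.2⟩

/-- The type of a port depends on its party, so the double reversal of a link is an equality in the
sigma type; here the equality of parties is between variables and can be substituted. -/
theorem port_sigma_congr {u v : Fin n} (h : u = v) (a : N.graph.neighborSet u)
    (b : N.graph.neighborSet v) (hab : (a : Fin n) = b) :
    (⟨u, N.port u a⟩ : Σ v, Fin (N.deg v)) = ⟨v, N.port v b⟩ := by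
  subst h
  rw [Subtype.ext hab]

theorem opposite_opposite (q : Σ v, Fin (N.deg v)) : N.opposite (N.opposite q) = q := by
  obtain ⟨v, p⟩ := q
  conv_rhs => rw [← (N.port v).apply_symm_apply p]
  exact N.port_sigma_congr (N.nbr_nbr v p) _ _ rfl

theorem opposite_bijective : Function.Bijective N.opposite :=
  Function.Involutive.bijective N.opposite_opposite

end Network

/-! ### Message transmission as a linear involution -/

section Dynamics

variable {n : ℕ} (N : Network n)

/-- Basis states of a network whose parties with `d` ports have workspaces with basis `W d`. -/
abbrev NetConfig (W : ℕ → Type) (L : ℕ) : Type := ∀ v : Fin n, Loc (W (N.deg v)) L (N.deg v)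

variable {N} {W : ℕ → Type} {L : ℕ}

/-- Exchange of the contents of the message registers at the ends of every link. -/
def swapMsgs (c : NetConfig N W L) : NetConfig N W L := fun v =>
  ((c v).1, (c v).2.1, (c v).2.2.1, fun p => (c (N.nbr v p)).2.2.2 (N.backPort v p))

theorem swapMsgs_swapMsgs (c : NetConfig N W L) : swapMsgs (swapMsgs c) = c := by
  funext v
  refine Prod.ext rfl (Prod.ext rfl (Prod.ext rfl (funext fun p => ?_)))
  exact congrArg (fun q : Σ v, Fin (N.deg v) => (c q.1).2.2.2 q.2) (N.opposite_opposite ⟨v, p⟩)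

/-- Linear extension of `swapMsgs`. -/
def exch : (NetConfig N W L → ℂ) →ₗ[ℂ] (NetConfig N W L → ℂ) :=
  LinearMap.funLeft ℂ ℂ swapMsgs

theorem exch_apply (ψ : NetConfig N W L → ℂ) (c : NetConfig N W L) :
    exch ψ c = ψ (swapMsgs c) := rfl

theorem exch_exch (ψ : NetConfig N W L → ℂ) : exch (exch ψ) = ψ := by
  funext c
  simp [exch_apply, swapMsgs_swapMsgs]

end Dynamics

/-! ### Tensor products of local operators -/

section Tensor

variable {ι : Type*} [Fintype ι] [DecidableEq ι] {X : ι → Type*} [∀ i, Fintype (X i)]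

/-- The tensor product of a family of square matrices. -/
def piTensor (U : ∀ i, Matrix (X i) (X i) ℂ) : Matrix (∀ i, X i) (∀ i, X i) ℂ :=
  Matrix.of fun c c' => ∏ i, U i (c i) (c' i)

theorem piTensor_apply (U : ∀ i, Matrix (X i) (X i) ℂ) (c c' : ∀ i, X i) :
    piTensor U c c' = ∏ i, U i (c i) (c' i) := rfl

theorem piTensor_mul (U V : ∀ i, Matrix (X i) (X i) ℂ) :
    piTensor (fun i => U i * V i) = piTensor U * piTensor V := by
  ext c c'
  simp only [piTensor_apply, Matrix.mul_apply, ← Finset.prod_mul_distrib]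
  rw [Fintype.prod_sum]

theorem piTensor_one [∀ i, DecidableEq (X i)] :
    piTensor (fun i => (1 : Matrix (X i) (X i) ℂ)) = 1 := by
  ext c c'
  simp only [piTensor_apply, Matrix.one_apply]
  by_cases h : c = c'
  · simp [h]
  · obtain ⟨i, hi⟩ := Function.ne_iff.1 h
    rw [if_neg h]
    exact Finset.prod_eq_zero (Finset.mem_univ i) (if_neg hi)

end Tensor

/-! ### Programs: composition, reversal and communication cost -/

section Programs

variable (W : ℕ → Type) (L : ℕ) [∀ d, Fintype (W d)] [∀ d, DecidableEq (W d)]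

/-- A sequence of local unitary operators separated by rounds of communication. -/
structure Prog where
  rounds : ℕ
  op : ℕ → ∀ d, Matrix.unitaryGroup (Loc (W d) L d) ℂ

end Programs

section Run

variable {n : ℕ} {N : Network n} {W : ℕ → Type} {L : ℕ} [∀ d, Fintype (W d)]
  [∀ d, DecidableEq (W d)]

/-- The action on states of simultaneous local unitary operators. -/
def localAct (N : Network n) (U : ∀ d, Matrix.unitaryGroup (Loc (W d) L d) ℂ) :
    (NetConfig N W L → ℂ) →ₗ[ℂ] (NetConfig N W L → ℂ) :=
  (piTensor fun v => (U (N.deg v) : Matrix _ _ ℂ)).mulVecLin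

theorem localAct_apply (U : ∀ d, Matrix.unitaryGroup (Loc (W d) L d) ℂ)
    (ψ : NetConfig N W L → ℂ) (c : NetConfig N W L) :
    localAct N U ψ c =
      ∑ c' : NetConfig N W L, (∏ v, (U (N.deg v) : Matrix _ _ ℂ) (c v) (c' v)) * ψ c' := rfl

theorem localAct_mul (U V : ∀ d, Matrix.unitaryGroup (Loc (W d) L d) ℂ)
    (ψ : NetConfig N W L → ℂ) :
    localAct N (fun d => U d * V d) ψ = localAct N U (localAct N V ψ) := by
  simp only [localAct, Matrix.mulVecLin_apply, Matrix.mulVec_mulVec, ← piTensor_mul]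
  rfl

theorem localAct_inv (U : ∀ d, Matrix.unitaryGroup (Loc (W d) L d) ℂ)
    (ψ : NetConfig N W L → ℂ) :
    localAct N (fun d => (U d)⁻¹) (localAct N U ψ) = ψ := by
  rw [← localAct_mul]
  simp only [inv_mul_cancel, localAct, Matrix.mulVecLin_apply]
  change (piTensor fun v : Fin n =>
    (1 : Matrix (Loc (W (N.deg v)) L (N.deg v)) (Loc (W (N.deg v)) L (N.deg v)) ℂ)).mulVec ψ = ψ
  rw [piTensor_one, Matrix.one_mulVec]

/-- The number of qubits sent through a port when the messages of the state `φ` are transmitted. -/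
def portBits (φ : NetConfig N W L → ℂ) (v : Fin n) (p : Fin (N.deg v)) : ℕ := by
  classical
  exact (Finset.univ.filter fun c : NetConfig N W L => φ c ≠ 0).sup
    fun c => ((c v).2.2.2 p).length

/-- The number of qubits sent in total when the messages of the state `φ` are transmitted. -/
def netBits (φ : NetConfig N W L → ℂ) : ℕ := ∑ v, ∑ p, portBits φ v p

/-- Turns the supremum into a condition on the support; equalities of counts are then proved by
comparing all upper bounds `k`. -/
theorem portBits_le_iff (φ : NetConfig N W L → ℂ) (v : Fin n) (p : Fin (N.deg v)) (k : ℕ) :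
    portBits φ v p ≤ k ↔ ∀ c, φ c ≠ 0 → ((c v).2.2.2 p).length ≤ k := by
  simp [portBits]

theorem portBits_exch (φ : NetConfig N W L → ℂ) (v : Fin n) (p : Fin (N.deg v)) :
    portBits (exch φ) v p = portBits φ (N.nbr v p) (N.backPort v p) := by
  refine eq_of_forall_ge_iff fun k => ?_
  rw [portBits_le_iff, portBits_le_iff]
  constructor
  · intro h c hc
    have := h (swapMsgs c) (by rwa [exch_apply, swapMsgs_swapMsgs])
    exact this
  · intro h c hc
    rw [exch_apply] at hc
    have := h _ hc
    have e : (swapMsgs (swapMsgs c) v).2.2.2 p = (c v).2.2.2 p := by rw [swapMsgs_swapMsgs]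
    rw [← e]
    exact this

/-- Transmission moves each count to the opposite end of its link, and `opposite` permutes the ends.
This is what makes a reversed round cost the same as the original one. -/
theorem netBits_exch (φ : NetConfig N W L → ℂ) : netBits (exch φ) = netBits φ := by
  simp only [netBits, portBits_exch]
  rw [← Fintype.sum_sigma', ← Fintype.sum_sigma']
  exact Fintype.sum_bijective N.opposite N.opposite_bijective _ _ fun q => rfl

theorem netBits_smul {a : ℂ} (ha : a ≠ 0) (φ : NetConfig N W L → ℂ) :
    netBits (a • φ) = netBits φ := by
  refine Finset.sum_congr rfl fun v _ => Finset.sum_congr rfl fun p _ => ?_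
  refine eq_of_forall_ge_iff fun k => ?_
  rw [portBits_le_iff, portBits_le_iff]
  refine forall_congr' fun c => ?_
  rw [Pi.smul_apply, smul_ne_zero_iff_right ha]

theorem netBits_zero : netBits (0 : NetConfig N W L → ℂ) = 0 := by
  refine Finset.sum_eq_zero fun v _ => Finset.sum_eq_zero fun p _ => ?_
  refine Nat.le_zero.1 ((portBits_le_iff _ v p 0).2 fun c hc => absurd rfl hc)

namespace Prog

variable (P Q : Prog W L)

/-- The state after `t` rounds. -/
def run (N : Network n) : ℕ → (NetConfig N W L → ℂ) →ₗ[ℂ] (NetConfig N W L → ℂ)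
  | 0 => LinearMap.id
  | t + 1 => exch ∘ₗ localAct N (P.op t) ∘ₗ run N t

/-- The state just before the transmission of round `t`. -/
def pre (N : Network n) (t : ℕ) : (NetConfig N W L → ℂ) →ₗ[ℂ] (NetConfig N W L → ℂ) :=
  localAct N (P.op t) ∘ₗ P.run N t

/-- The state at the end. -/
def final (N : Network n) : (NetConfig N W L → ℂ) →ₗ[ℂ] (NetConfig N W L → ℂ) := P.pre N P.rounds

/-- The number of qubits sent. -/
def cost (ψ : NetConfig N W L → ℂ) : ℕ := ∑ t ∈ Finset.range P.rounds, netBits (P.pre N t ψ)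

theorem run_succ (t : ℕ) (ψ : NetConfig N W L → ℂ) :
    P.run N (t + 1) ψ = exch (P.pre N t ψ) := rfl

theorem pre_apply (t : ℕ) (ψ : NetConfig N W L → ℂ) :
    P.pre N t ψ = localAct N (P.op t) (P.run N t ψ) := rfl

/-- A single local operator, without communication. -/
def gate (U : ∀ d, Matrix.unitaryGroup (Loc (W d) L d) ℂ) : Prog W L where
  rounds := 0
  op _ := U

theorem final_gate (U : ∀ d, Matrix.unitaryGroup (Loc (W d) L d) ℂ) (ψ : NetConfig N W L → ℂ) :
    (gate U).final N ψ = localAct N U ψ := rfl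

theorem cost_gate (U : ∀ d, Matrix.unitaryGroup (Loc (W d) L d) ℂ) (ψ : NetConfig N W L → ℂ) :
    (gate U).cost ψ = 0 := rfl

/-- The program which runs `P` and then `Q`. -/
def andThen : Prog W L where
  rounds := P.rounds + Q.rounds
  -- No transmission separates the final operator of `P` from the first of `Q`, so the two merge at
  -- time `P.rounds`.
  op t d := if t < P.rounds then P.op t d
    else if t = P.rounds then Q.op 0 d * P.op t d else Q.op (t - P.rounds) d

theorem run_andThen_of_le (ψ : NetConfig N W L → ℂ) {t : ℕ} (ht : t ≤ P.rounds) :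
    (P.andThen Q).run N t ψ = P.run N t ψ := by
  induction t with
  | zero => rfl
  | succ t ih =>
    rw [run_succ, run_succ, pre_apply, pre_apply, ih (by omega)]
    have : (P.andThen Q).op t = P.op t := by
      funext d
      simp [andThen, show t < P.rounds by omega]
    rw [this]

theorem pre_andThen_of_lt (ψ : NetConfig N W L → ℂ) {t : ℕ} (ht : t < P.rounds) :
    (P.andThen Q).pre N t ψ = P.pre N t ψ := by
  rw [pre_apply, pre_apply, run_andThen_of_le P Q ψ ht.le]
  have : (P.andThen Q).op t = P.op t := by
    funext d
    simp [andThen, ht]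
  rw [this]

theorem pre_andThen_add (ψ : NetConfig N W L → ℂ) (t : ℕ) :
    (P.andThen Q).pre N (P.rounds + t) ψ = Q.pre N t (P.final N ψ) := by
  induction t with
  | zero =>
    rw [add_zero, pre_apply, run_andThen_of_le P Q ψ le_rfl]
    have : (P.andThen Q).op P.rounds = fun d => Q.op 0 d * P.op P.rounds d := by
      funext d
      simp [andThen]
    rw [this, localAct_mul]
    rfl
  | succ t ih =>
    rw [pre_apply, ← add_assoc, run_succ, ih, pre_apply Q (t + 1), run_succ]
    have : (P.andThen Q).op (P.rounds + t + 1) = Q.op (t + 1) := by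
      funext d
      simp [andThen, add_assoc]
    rw [this]

theorem final_andThen (ψ : NetConfig N W L → ℂ) :
    (P.andThen Q).final N ψ = Q.final N (P.final N ψ) :=
  pre_andThen_add P Q ψ Q.rounds

theorem cost_andThen (ψ : NetConfig N W L → ℂ) :
    (P.andThen Q).cost ψ = P.cost ψ + Q.cost (P.final N ψ) := by
  refine (Finset.sum_range_add _ P.rounds Q.rounds).trans (congrArg₂ _ ?_ ?_)
  · refine Finset.sum_congr rfl fun t ht => ?_
    rw [pre_andThen_of_lt P Q ψ (Finset.mem_range.1 ht)]
  · exact Finset.sum_congr rfl fun t _ => by rw [pre_andThen_add]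

theorem cost_smul {a : ℂ} (ha : a ≠ 0) (ψ : NetConfig N W L → ℂ) :
    P.cost (a • ψ) = P.cost ψ := by
  refine Finset.sum_congr rfl fun t _ => ?_
  rw [map_smul, netBits_smul ha]

theorem cost_zero : P.cost (0 : NetConfig N W L → ℂ) = 0 := by
  refine Finset.sum_eq_zero fun t _ => ?_
  rw [map_zero, netBits_zero]

/-- The program which runs `P`, then applies a local operator `D`, and then runs `P` backwards. -/
def conj (D : ∀ d, Matrix.unitaryGroup (Loc (W d) L d) ℂ) : Prog W L where
  rounds := 2 * P.rounds
  -- At the turning point the last operator of `P`, then `D`, then the inverse of the last operator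
  -- act with no transmission in between. Afterwards the operators are undone in reverse order.
  op t d := if t < P.rounds then P.op t d
    else if t = P.rounds then (P.op t d)⁻¹ * (D d * P.op t d) else (P.op (2 * P.rounds - t) d)⁻¹

variable (D : ∀ d, Matrix.unitaryGroup (Loc (W d) L d) ℂ)

theorem run_conj_of_le (ψ : NetConfig N W L → ℂ) {t : ℕ} (ht : t ≤ P.rounds) :
    (P.conj D).run N t ψ = P.run N t ψ := by
  induction t with
  | zero => rfl
  | succ t ih =>
    rw [run_succ, run_succ, pre_apply, pre_apply, ih (by omega)]
    have : (P.conj D).op t = P.op t := by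
      funext d
      simp [conj, show t < P.rounds by omega]
    rw [this]

theorem pre_conj_of_lt (ψ : NetConfig N W L → ℂ) {t : ℕ} (ht : t < P.rounds) :
    (P.conj D).pre N t ψ = P.pre N t ψ := by
  rw [pre_apply, pre_apply, run_conj_of_le P D ψ ht.le]
  have : (P.conj D).op t = P.op t := by
    funext d
    simp [conj, ht]
  rw [this]

/-- The hypothesis says that `D` turns the outcome of `P` on `ψ` into its outcome on `ψ'`, so the
second half retraces the run from `ψ'`: exchanges cancel because they are involutions, and local
operators cancel their inverses. -/
theorem pre_conj_add {ψ ψ' : NetConfig N W L → ℂ}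
    (h : localAct N D (P.final N ψ) = P.final N ψ') {j : ℕ} (hj : j ≤ P.rounds) :
    (P.conj D).pre N (P.rounds + j) ψ = P.run N (P.rounds - j) ψ' := by
  induction j with
  | zero =>
    rw [add_zero, pre_apply, run_conj_of_le P D ψ le_rfl]
    have : (P.conj D).op P.rounds = fun d => (P.op P.rounds d)⁻¹ * (D d * P.op P.rounds d) := by
      funext d
      simp [conj]
    rw [this, localAct_mul (fun d => (P.op P.rounds d)⁻¹), localAct_mul D]
    change localAct N _ (localAct N D (P.final N ψ)) = _
    rw [h]
    exact localAct_inv (P.op P.rounds) _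
  | succ j ih =>
    obtain ⟨k, hk⟩ : ∃ k, P.rounds = k + (j + 1) := ⟨P.rounds - (j + 1), by omega⟩
    rw [pre_apply, ← add_assoc, run_succ, ih (by omega)]
    have : (P.conj D).op (P.rounds + j + 1) = fun d => (P.op k d)⁻¹ := by
      funext d
      simp [conj, show ¬ P.rounds + j + 1 < P.rounds by omega,
        show ¬ P.rounds + j + 1 = P.rounds by omega,
        show 2 * P.rounds - (P.rounds + j + 1) = k by omega]
    rw [this, show P.rounds - j = k + 1 by omega, show P.rounds - (j + 1) = k by omega,
      run_succ, exch_exch, pre_apply, localAct_inv]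

theorem final_conj {ψ ψ' : NetConfig N W L → ℂ}
    (h : localAct N D (P.final N ψ) = P.final N ψ') : (P.conj D).final N ψ = ψ' := by
  have := pre_conj_add P D h le_rfl
  rw [Nat.sub_self, ← two_mul] at this
  exact this

/-- The first half is the run from `ψ`. The second transmits, in reverse order, the states that `P`
started from `ψ'` has just after its transmissions; by `netBits_exch` they count the same as just
before. -/
theorem cost_conj {ψ ψ' : NetConfig N W L → ℂ}
    (h : localAct N D (P.final N ψ) = P.final N ψ') : (P.conj D).cost ψ = P.cost ψ + P.cost ψ' := by
  rw [cost, show (P.conj D).rounds = P.rounds + P.rounds from two_mul _]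
  refine (Finset.sum_range_add _ P.rounds P.rounds).trans (congrArg₂ _ ?_ ?_)
  · refine Finset.sum_congr rfl fun t ht => ?_
    rw [pre_conj_of_lt P D ψ (Finset.mem_range.1 ht)]
  · rw [cost, ← Finset.sum_range_reflect]
    refine Finset.sum_congr rfl fun t ht => ?_
    have ht := Finset.mem_range.1 ht
    rw [pre_conj_add P D h (by omega), show P.rounds - (P.rounds - 1 - t) = t + 1 by omega,
      run_succ, netBits_exch]

end Prog

end Run

/-! ### Embedding programs into larger registers -/

section Extension

variable {X Y : Type} [Fintype X] [DecidableEq X] [Fintype Y] [DecidableEq Y]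

open Classical in
/-- The decomposition of a type into the range of an embedding and its complement. -/
def rangeSumCompl (e : X ↪ Y) : X ⊕ {y // y ∉ Set.range e} ≃ Y :=
  (Equiv.sumCongr (Equiv.ofInjective e e.injective) (Equiv.refl _)).trans
    (Equiv.sumCompl (· ∈ Set.range e))

theorem rangeSumCompl_symm_apply (e : X ↪ Y) (x : X) : (rangeSumCompl e).symm (e x) = Sum.inl x := by
  rw [Equiv.symm_apply_eq]
  simp [rangeSumCompl]

theorem rangeSumCompl_symm_of_notMem (e : X ↪ Y) {y : Y} (hy : y ∉ Set.range e) :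
    (rangeSumCompl e).symm y = Sum.inr ⟨y, hy⟩ := by
  rw [Equiv.symm_apply_eq]
  simp [rangeSumCompl]

open Classical in
/-- The matrix acting as `U` on the range of an embedding and as the identity elsewhere. -/
def extendMatrix (e : X ↪ Y) (U : Matrix X X ℂ) : Matrix Y Y ℂ :=
  (Matrix.fromBlocks U 0 0 1).submatrix (rangeSumCompl e).symm (rangeSumCompl e).symm

theorem extendMatrix_apply (e : X ↪ Y) (U : Matrix X X ℂ) (a b : X) :
    extendMatrix e U (e a) (e b) = U a b := by
  simp [extendMatrix, rangeSumCompl_symm_apply]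

theorem extendMatrix_of_notMem (e : X ↪ Y) (U : Matrix X X ℂ) {y : Y} (hy : y ∉ Set.range e)
    (b : X) : extendMatrix e U y (e b) = 0 := by
  simp [extendMatrix, rangeSumCompl_symm_apply, rangeSumCompl_symm_of_notMem e hy]

theorem extendMatrix_mem_unitary (e : X ↪ Y) (U : Matrix.unitaryGroup X ℂ) :
    extendMatrix e U ∈ Matrix.unitaryGroup Y ℂ := by
  classical
  have h := Matrix.mem_unitaryGroup_iff.1 U.2
  rw [Matrix.star_eq_conjTranspose] at h
  rw [Matrix.mem_unitaryGroup_iff, Matrix.star_eq_conjTranspose, extendMatrix,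
    Matrix.conjTranspose_submatrix, Matrix.submatrix_mul_equiv, Matrix.fromBlocks_conjTranspose,
    Matrix.fromBlocks_multiply]
  simp [h]

end Extension

/-- Inclusion of the messages of length at most `L` into those of length at most `L'`. -/
def msgEmb {L L' : ℕ} (h : L ≤ L') : Msg L ↪ Msg L' where
  toFun m := ⟨Fin.castLE (Nat.succ_le_succ h) m.1, m.2⟩
  inj' := by
    rintro ⟨⟨k, hk⟩, s⟩ ⟨⟨l, hl⟩, s'⟩ hm
    obtain ⟨h1, h2⟩ := Sigma.mk.inj hm
    obtain rfl : k = l := congrArg Fin.val h1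
    exact congrArg _ (eq_of_heq h2)

/-- Embedding of the registers of a party into larger ones. -/
def locEmb {W W' : Type} {L L' : ℕ} (w : W ↪ W') (h : L ≤ L') (d : ℕ) : Loc W L d ↪ Loc W' L' d :=
  (Function.Embedding.refl _).prodMap <| (Function.Embedding.refl _).prodMap <|
    w.prodMap <| Function.Embedding.arrowCongrRight (msgEmb h)

section NetExtension

variable {n : ℕ} {N : Network n} {W W' : ℕ → Type} {L L' : ℕ} [∀ d, Fintype (W d)]
  [∀ d, DecidableEq (W d)] [∀ d, Fintype (W' d)] [∀ d, DecidableEq (W' d)]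
  (w : ∀ d, W d ↪ W' d) (h : L ≤ L')

/-- Embedding of the basis states of a network into those of a network with larger registers. -/
def netEmb (c : NetConfig N W L) : NetConfig N W' L' := fun v => locEmb (w _) h _ (c v)

theorem netEmb_injective :
    Function.Injective (netEmb w h : NetConfig N W L → NetConfig N W' L') := fun _ _ hc =>
  funext fun v => (locEmb (w _) h _).injective (congrFun hc v)

theorem swapMsgs_netEmb (c : NetConfig N W L) :
    swapMsgs (netEmb w h c) = netEmb w h (swapMsgs c) := rfl

/-- A state regarded as a state of a network with larger registers. -/
def extState (ψ : NetConfig N W L → ℂ) : NetConfig N W' L' → ℂ :=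
  Function.extend (netEmb w h) ψ 0

theorem extState_netEmb (ψ : NetConfig N W L → ℂ) (c : NetConfig N W L) :
    extState w h ψ (netEmb w h c) = ψ c :=
  (netEmb_injective w h).extend_apply _ _ _

theorem extState_of_notMem (ψ : NetConfig N W L → ℂ) {c : NetConfig N W' L'}
    (hc : c ∉ Set.range (netEmb w h)) : extState w h ψ c = 0 :=
  Function.extend_apply' _ _ _ hc

theorem extState_eq {ψ : NetConfig N W L → ℂ} {φ : NetConfig N W' L' → ℂ}
    (h1 : ∀ c, φ (netEmb w h c) = ψ c) (h2 : ∀ c, c ∉ Set.range (netEmb w h) → φ c = 0) :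
    φ = extState w h ψ := by
  funext c
  by_cases hc : c ∈ Set.range (netEmb w h : NetConfig N W L → NetConfig N W' L')
  · obtain ⟨a, rfl⟩ := hc
    rw [h1, extState_netEmb]
  · rw [h2 c hc, extState_of_notMem w h ψ hc]

theorem exch_extState (ψ : NetConfig N W L → ℂ) :
    exch (extState w h ψ) = extState w h (exch ψ) := by
  refine extState_eq w h (fun c => ?_) fun c hc => ?_
  · rw [exch_apply, swapMsgs_netEmb, extState_netEmb, exch_apply]
  · rw [exch_apply]
    refine extState_of_notMem w h ψ ?_
    rintro ⟨a, ha⟩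
    exact hc ⟨swapMsgs a, by rw [← swapMsgs_netEmb, ha, swapMsgs_swapMsgs]⟩

theorem netBits_extState (ψ : NetConfig N W L → ℂ) : netBits (extState w h ψ) = netBits ψ := by
  refine Finset.sum_congr rfl fun v _ => Finset.sum_congr rfl fun p _ => ?_
  refine eq_of_forall_ge_iff fun k => ?_
  rw [portBits_le_iff, portBits_le_iff]
  constructor
  · intro H c hc
    exact H (netEmb w h c) (by rwa [extState_netEmb])
  · intro H c hc
    by_cases hr : c ∈ Set.range (netEmb w h : NetConfig N W L → NetConfig N W' L')
    · obtain ⟨a, rfl⟩ := hr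
      rw [extState_netEmb] at hc
      exact H a hc
    · exact absurd (extState_of_notMem w h ψ hr) hc

/-- Local operators regarded as operators on larger registers. -/
def extOp (U : ∀ d, Matrix.unitaryGroup (Loc (W d) L d) ℂ) (d : ℕ) :
    Matrix.unitaryGroup (Loc (W' d) L' d) ℂ :=
  ⟨extendMatrix (locEmb (w d) h d) (U d), extendMatrix_mem_unitary _ _⟩

/-- The extended operators are block diagonal. Only embedded basis states contribute to the sum, and
an outcome outside the range has some party outside its local range, where the matrix factor
vanishes. -/
theorem localAct_extOp (U : ∀ d, Matrix.unitaryGroup (Loc (W d) L d) ℂ)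
    (ψ : NetConfig N W L → ℂ) :
    localAct N (extOp w h U) (extState w h ψ) = extState w h (localAct N U ψ) := by
  have key (c : NetConfig N W' L') : localAct N (extOp w h U) (extState w h ψ) c =
      ∑ b : NetConfig N W L, (∏ v, extendMatrix (locEmb (w (N.deg v)) h (N.deg v))
        (U (N.deg v)) (c v) (locEmb (w (N.deg v)) h (N.deg v) (b v))) * ψ b := by
    rw [localAct_apply]
    refine (Fintype.sum_of_injective (netEmb w h) (netEmb_injective w h) _ _
      (fun b hb => ?_) fun b => ?_).symm
    · rw [extState_of_notMem w h ψ hb, mul_zero]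
    · rw [extState_netEmb]
      rfl
  refine extState_eq w h (fun c => ?_) fun c hc => ?_
  · rw [key, localAct_apply]
    refine Finset.sum_congr rfl fun b _ => ?_
    congr 1
    exact Finset.prod_congr rfl fun v _ => extendMatrix_apply _ _ _ _
  · obtain ⟨v, hv⟩ : ∃ v, c v ∉ Set.range (locEmb (w (N.deg v)) h (N.deg v)) := by
      by_contra! H
      choose a ha using H
      exact hc ⟨a, funext ha⟩
    rw [key]
    refine Finset.sum_eq_zero fun b _ => ?_
    rw [Finset.prod_eq_zero (Finset.mem_univ v) (extendMatrix_of_notMem _ _ hv _), zero_mul]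

namespace Prog

/-- A program regarded as a program on larger registers. -/
def ext (P : Prog W L) : Prog W' L' where
  rounds := P.rounds
  op t := extOp w h (P.op t)

variable (P : Prog W L)

theorem run_ext (ψ : NetConfig N W L → ℂ) (t : ℕ) :
    (P.ext w h).run N t (extState w h ψ) = extState w h (P.run N t ψ) := by
  induction t with
  | zero => rfl
  | succ t ih =>
    rw [run_succ, pre_apply, ih, run_succ, pre_apply, ← exch_extState, ← localAct_extOp]
    rfl

theorem pre_ext (ψ : NetConfig N W L → ℂ) (t : ℕ) :
    (P.ext w h).pre N t (extState w h ψ) = extState w h (P.pre N t ψ) := by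
  rw [pre_apply, run_ext, pre_apply, ← localAct_extOp]
  rfl

theorem final_ext (ψ : NetConfig N W L → ℂ) :
    (P.ext w h).final N (extState w h ψ) = extState w h (P.final N ψ) :=
  pre_ext w h P ψ P.rounds

theorem cost_ext (ψ : NetConfig N W L → ℂ) :
    (P.ext w h).cost (extState w h ψ) = P.cost ψ :=
  Finset.sum_congr rfl fun t _ => by rw [pre_ext, netBits_extState]

end Prog

end NetExtension

/-! ### Elementary gates acting on initial states -/

section Gates

variable {n : ℕ} {N : Network n} {W : ℕ → Type} {L : ℕ} [∀ d, Fintype (W d)]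
  [∀ d, DecidableEq (W d)] (i : ∀ d, W d)

/-- The basis state with input `x` and all other registers in their initial states. -/
def initConfig (N : Network n) (L : ℕ) (x : Fin n → Bool) : NetConfig N W L :=
  fun v => (x v, true, i (N.deg v), fun _ => Msg.blank)

theorem initConfig_injective : Function.Injective (initConfig i N L) := fun _ _ h =>
  funext fun v => congrArg Prod.fst (congrFun h v)

theorem mem_range_initConfig (c : NetConfig N W L) :
    c ∈ Set.range (initConfig i N L) ↔
      ∀ v, (c v).2 = (true, i (N.deg v), fun _ => Msg.blank) := by
  constructor
  · rintro ⟨x, rfl⟩ v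
    rfl
  · intro h
    exact ⟨fun v => (c v).1, funext fun v => Prod.ext rfl (h v).symm⟩

/-- The initial state on the input `∑ₓ α x |x⟩`. -/
def initState (N : Network n) (L : ℕ) : ((Fin n → Bool) → ℂ) →ₗ[ℂ] (NetConfig N W L → ℂ) where
  toFun α := by
    classical
    exact fun c => if ∀ v, (c v).2 = (true, i (N.deg v), fun _ => Msg.blank) then
      α fun v => (c v).1 else 0
  map_add' α β := by
    funext c
    simp only [Pi.add_apply]
    split_ifs <;> simp
  map_smul' a α := by
    funext c
    simp only [Pi.smul_apply, RingHom.id_apply]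
    split_ifs <;> simp

theorem initState_initConfig (α : (Fin n → Bool) → ℂ) (x : Fin n → Bool) :
    initState i N L α (initConfig i N L x) = α x :=
  if_pos fun _ => rfl

theorem initState_of_notMem (α : (Fin n → Bool) → ℂ) {c : NetConfig N W L}
    (hc : c ∉ Set.range (initConfig i N L)) : initState i N L α c = 0 :=
  if_neg fun h => hc ((mem_range_initConfig i c).2 h)

theorem eq_initState {α : (Fin n → Bool) → ℂ} {φ : NetConfig N W L → ℂ}
    (h1 : ∀ x, φ (initConfig i N L x) = α x)
    (h2 : ∀ c, c ∉ Set.range (initConfig i N L) → φ c = 0) : φ = initState i N L α := by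
  funext c
  by_cases hc : c ∈ Set.range (initConfig i N L)
  · obtain ⟨x, rfl⟩ := hc
    rw [h1, initState_initConfig]
  · rw [h2 c hc, initState_of_notMem i α hc]

theorem extState_initState {W' : ℕ → Type} {L' : ℕ} [∀ d, Fintype (W' d)]
    [∀ d, DecidableEq (W' d)] (w : ∀ d, W d ↪ W' d) (h : L ≤ L') {i' : ∀ d, W' d}
    (hi : ∀ d, w d (i d) = i' d) (α : (Fin n → Bool) → ℂ) :
    extState w h (initState i N L α) = initState i' N L' α := by
  obtain rfl : (fun d => w d (i d)) = i' := funext hi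
  have e (x : Fin n → Bool) :
      initConfig (fun d => w d (i d)) N L' x = netEmb w h (initConfig i N L x) := rfl
  refine eq_initState _ (fun x => ?_) fun c hc => ?_
  · rw [e, extState_netEmb, initState_initConfig]
  · by_cases hr : c ∈ Set.range (netEmb w h : NetConfig N W L → NetConfig N W' L')
    · obtain ⟨a, rfl⟩ := hr
      rw [extState_netEmb]
      refine initState_of_notMem i α ?_
      rintro ⟨x, rfl⟩
      exact hc ⟨x, rfl⟩
    · exact extState_of_notMem w h _ hr

/-- A unitary operator applied to the input qubit. -/
def inputGate (R : Matrix.unitaryGroup Bool ℂ) (d : ℕ) :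
    Matrix.unitaryGroup (Loc (W d) L d) ℂ :=
  ⟨Matrix.kroneckerMap (· * ·) R 1, Matrix.kronecker_mem_unitary R.2 (one_mem _)⟩

theorem inputGate_apply (R : Matrix.unitaryGroup Bool ℂ) (d : ℕ) (a b : Loc (W d) L d) :
    (inputGate R d : Matrix.unitaryGroup (Loc (W d) L d) ℂ).1 a b = R.1 a.1 b.1 * (if a.2 = b.2 then 1 else 0) := by
  simp [inputGate, Matrix.kroneckerMap_apply, Matrix.one_apply]

/-- Only input qubits are touched, so the state remains an initial one and can be tracked through
its amplitudes on bit strings alone. -/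
theorem localAct_inputGate (R : Matrix.unitaryGroup Bool ℂ) (α : (Fin n → Bool) → ℂ) :
    localAct N (inputGate R) (initState i N L α) =
      initState i N L ((piTensor fun _ : Fin n => R.1).mulVec α) := by
  have key (c : NetConfig N W L) : localAct N (inputGate R) (initState i N L α) c =
      ∑ x : Fin n → Bool, (∏ v, R.1 (c v).1 (x v) *
        (if (c v).2 = (true, i (N.deg v), fun _ => Msg.blank) then 1 else 0)) * α x := by
    rw [localAct_apply]
    refine (Fintype.sum_of_injective (initConfig i N L) (initConfig_injective i) _ _
      (fun b hb => ?_) fun x => ?_).symm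
    · rw [initState_of_notMem i α hb, mul_zero]
    · rw [initState_initConfig]
      simp only [inputGate_apply]
      rfl
  refine eq_initState i (fun x => ?_) fun c hc => ?_
  · rw [key]
    refine Finset.sum_congr rfl fun y _ => ?_
    simp [initConfig, piTensor_apply]
  · obtain ⟨v, hv⟩ := not_forall.1 ((mem_range_initConfig i c).not.1 hc)
    rw [key]
    refine Finset.sum_eq_zero fun b _ => ?_
    rw [Finset.prod_eq_zero (Finset.mem_univ v) (by rw [if_neg hv, mul_zero]), zero_mul]

theorem final_inputGate (R : Matrix.unitaryGroup Bool ℂ) (α : (Fin n → Bool) → ℂ) :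
    (Prog.gate (inputGate R)).final N (initState i N L α) =
      initState i N L ((piTensor fun _ : Fin n => R.1).mulVec α) :=
  localAct_inputGate i R α

/-- A phase applied if the output qubit is `true`. -/
def phaseGate (z : unitary ℂ) (d : ℕ) : Matrix.unitaryGroup (Loc (W d) L d) ℂ :=
  ⟨Matrix.diagonal fun l => if l.2.1 then (z : ℂ) else 1, by
    rw [Matrix.mem_unitaryGroup_iff, Matrix.star_eq_conjTranspose, Matrix.diagonal_conjTranspose,
      Matrix.diagonal_mul_diagonal, ← Matrix.diagonal_one]
    congr 1
    funext l
    simp only [Pi.star_apply]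
    split_ifs
    · exact Unitary.coe_mul_star_self z
    · simp⟩

theorem localAct_phaseGate (z : unitary ℂ) (φ : NetConfig N W L → ℂ) (c : NetConfig N W L) :
    localAct N (phaseGate z) φ c = (∏ v, if (c v).2.1 then (z : ℂ) else 1) * φ c := by
  rw [localAct_apply, Finset.sum_eq_single c]
  · simp [phaseGate]
  · intro b _ hb
    obtain ⟨v, hv⟩ := Function.ne_iff.1 hb
    rw [Finset.prod_eq_zero (Finset.mem_univ v), zero_mul]
    simp [phaseGate, Matrix.diagonal_apply_ne' _ hv]
  · simp

/-- The output qubit is flipped if the input qubit is `false`. -/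
def copyPerm (Y : Type) : Equiv.Perm (Bool × Bool × Y) :=
  Function.Involutive.toPerm (fun l => (l.1, xor l.2.1 (!l.1), l.2.2)) fun l => by simp

/-- The gate of `copyPerm`. -/
def copyGate (d : ℕ) : Matrix.unitaryGroup (Loc (W d) L d) ℂ :=
  ⟨(copyPerm _).permMatrix ℂ, by
    rw [Matrix.mem_unitaryGroup_iff, Matrix.star_eq_conjTranspose, Matrix.conjTranspose_permMatrix,
      ← Matrix.permMatrix_mul, inv_mul_cancel, Matrix.permMatrix_one]⟩

theorem copyGate_apply_ne_zero {d : ℕ} {a b : Loc (W d) L d}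
    (h : (copyGate d : Matrix.unitaryGroup (Loc (W d) L d) ℂ).1 a b ≠ 0) : copyPerm _ a = b := by
  by_contra hab
  refine h ?_
  simp [copyGate, Equiv.Perm.permMatrix, PEquiv.toMatrix_apply, Equiv.toPEquiv_apply,
    Option.mem_def, hab]

theorem outBit_eq_of_copyGate {α : (Fin n → Bool) → ℂ} {c : NetConfig N W L}
    (h : localAct N copyGate (initState i N L α) c ≠ 0) :
    ∃ x, α x ≠ 0 ∧ ∀ v, (c v).2.1 = x v := by
  rw [localAct_apply] at h
  obtain ⟨b, -, hb⟩ := Finset.exists_ne_zero_of_sum_ne_zero h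
  have hr : b ∈ Set.range (initConfig i N L) := by
    by_contra hr
    exact right_ne_zero_of_mul hb (initState_of_notMem i α hr)
  obtain ⟨x, rfl⟩ := hr
  refine ⟨x, ?_, fun v => ?_⟩
  · have := right_ne_zero_of_mul hb
    rwa [initState_initConfig] at this
  · have hv := copyGate_apply_ne_zero (Finset.prod_ne_zero_iff.1 (left_ne_zero_of_mul hb) v
      (Finset.mem_univ v))
    have h1 : (c v).1 = x v := congrArg Prod.fst hv
    have h2 : xor (c v).2.1 (!(c v).1) = true := congrArg (fun l => l.2.1) hv
    rw [← h1]
    revert h2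
    cases (c v).1 <;> cases (c v).2.1 <;> simp

end Gates

/-- The change of sign of the amplitudes of the inputs satisfying `f`. -/
def signFlip {n : ℕ} (f : (Fin n → Bool) → Bool) (α : (Fin n → Bool) → ℂ) :
    (Fin n → Bool) → ℂ := fun x => if f x then -α x else α x

/-! ### Sign flips from exact algorithms -/

namespace QAlgorithm

variable (A : QAlgorithm) {n : ℕ} {N : Network n}

/-- The program run by an algorithm on networks of `n` parties. -/
def prog (n : ℕ) : Prog (A.Work n) (A.msgLen n) where
  rounds := A.rounds n
  op := A.op n

theorem inputState_eq (α : (Fin n → Bool) → ℂ) :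
    A.inputState α = initState (A.workInit n) N (A.msgLen n) α := rfl

theorem stateAfter_eq (ψ : A.State N) (t : ℕ) : A.stateAfter ψ t = (A.prog n).run N t ψ := by
  induction t with
  | zero => rfl
  | succ t ih =>
    rw [Prog.run_succ, Prog.pre_apply, ← ih]
    rfl

theorem finalState_eq (ψ : A.State N) : A.finalState ψ = (A.prog n).final N ψ := by
  rw [finalState, stateAfter_eq]
  rfl

theorem bits_eq (ψ : A.State N) : A.bits ψ = (A.prog n).cost ψ := by
  refine Finset.sum_congr rfl fun t _ => Finset.sum_congr rfl fun v _ =>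
    Finset.sum_congr rfl fun p _ => ?_
  rw [Prog.pre_apply, ← stateAfter_eq]
  rfl

/-- The cost depends only on supports and so ignores nonzero scalars: a nonzero `α` may be
normalized, and the zero state costs nothing. Norms therefore need not be followed through the
amplification. -/
theorem bits_le_worstCaseBits (α : (Fin n → Bool) → ℂ) :
    (A.bits (A.inputState (N := N) α) : ℕ∞) ≤ A.worstCaseBits N := by
  by_cases hα : α = 0
  · rw [inputState_eq, hα, map_zero, bits_eq, Prog.cost_zero]
    exact zero_le
  have hpos : 0 < ∑ x, ‖α x‖ ^ 2 := by
    obtain ⟨x, hx⟩ := Function.ne_iff.1 hα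
    exact Finset.sum_pos' (fun _ _ => by positivity)
      ⟨x, Finset.mem_univ x, by have := norm_pos_iff.2 hx; positivity⟩
  set r := Real.sqrt (∑ x, ‖α x‖ ^ 2) with hr
  have hr0 : 0 < r := Real.sqrt_pos.2 hpos
  have hr2 : r ^ 2 = ∑ x, ‖α x‖ ^ 2 := Real.sq_sqrt hpos.le
  have hr' : ((r⁻¹ : ℝ) : ℂ) ≠ 0 := by exact_mod_cast (inv_pos.2 hr0).ne'
  have hnorm : ∑ x, ‖(((r⁻¹ : ℝ) : ℂ) • α) x‖ ^ 2 = 1 := by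
    simp only [Pi.smul_apply, smul_eq_mul, norm_mul, mul_pow, Complex.norm_real, Real.norm_eq_abs,
      sq_abs, ← Finset.mul_sum, ← hr2]
    field_simp
  have hle : (A.bits (A.inputState (N := N) (((r⁻¹ : ℝ) : ℂ) • α)) : ℕ∞) ≤ A.worstCaseBits N :=
    le_iSup₂ (f := fun (β : (Fin n → Bool) → ℂ) (_ : ∑ x, ‖β x‖ ^ 2 = 1) =>
      (A.bits (A.inputState (N := N) β) : ℕ∞)) _ hnorm
  rwa [inputState_eq, map_smul, bits_eq, Prog.cost_smul _ hr', ← bits_eq, ← inputState_eq] at hle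

variable {A}

/-- By linearity it suffices to treat classical inputs. On the support of the outcome for `x` every
party outputs `f x`, so the `n` local phases multiply to `z ^ n = -1` or to 1. -/
theorem ExactlyComputes.localAct_phaseGate {f : (Fin n → Bool) → Bool}
    (hf : A.ExactlyComputes N f) {z : unitary ℂ} (hz : (z : ℂ) ^ n = -1)
    (α : (Fin n → Bool) → ℂ) :
    localAct N (phaseGate z) ((A.prog n).final N (A.inputState α)) =
      (A.prog n).final N (A.inputState (signFlip f α)) := by
  have expand (β : (Fin n → Bool) → ℂ) (c : A.Config N) :
      (A.prog n).final N (A.inputState β) c =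
        ∑ x, β x * (A.prog n).final N (A.classicalInput x) c := by
    have : β = ∑ x, β x • Pi.single x (1 : ℂ) := by
      funext y
      simp [Finset.sum_apply, Pi.single_apply]
    conv_lhs => rw [this, inputState_eq, map_sum, map_sum, Finset.sum_apply]
    refine Finset.sum_congr rfl fun x _ => ?_
    rw [map_smul, map_smul]
    rfl
  funext c
  rw [AnonymousQuantumNetwork.localAct_phaseGate, expand, expand, Finset.mul_sum]
  refine Finset.sum_congr rfl fun x _ => ?_
  by_cases hc : (A.prog n).final N (A.classicalInput x) c = 0
  · rw [hc, mul_zero, mul_zero, mul_zero]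
  · have hout (v : Fin n) : (c v).2.1 = f x :=
      (hf x c (by rwa [finalState_eq]) v).2
    simp only [hout, Finset.prod_const, Finset.card_univ, Fintype.card_fin, signFlip]
    cases f x
    · simp
    · simp [hz]

section Flip

variable {W : ℕ → Type} {L : ℕ} [∀ d, Fintype (W d)] [∀ d, DecidableEq (W d)] {i : ∀ d, W d}
  (w : ∀ d, A.Work n d ↪ W d) (h : A.msgLen n ≤ L)

variable (A) in
/-- The program which flips the sign of the inputs satisfying the function computed by `A`. -/
def flip (z : unitary ℂ) : Prog W L := ((A.prog n).conj (phaseGate z)).ext w h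

variable {f : (Fin n → Bool) → Bool} {z : unitary ℂ}

theorem final_flip (hf : A.ExactlyComputes N f) (hz : (z : ℂ) ^ n = -1)
    (hi : ∀ d, w d (A.workInit n d) = i d) (α : (Fin n → Bool) → ℂ) :
    (A.flip w h z).final N (initState i N L α) = initState i N L (signFlip f α) := by
  rw [flip, ← extState_initState (A.workInit n) w h hi α, Prog.final_ext, ← inputState_eq,
    Prog.final_conj _ _ (hf.localAct_phaseGate hz α), inputState_eq,
    extState_initState (A.workInit n) w h hi]

theorem cost_flip_le (hf : A.ExactlyComputes N f) (hz : (z : ℂ) ^ n = -1)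
    (hi : ∀ d, w d (A.workInit n d) = i d) (α : (Fin n → Bool) → ℂ) :
    ((A.flip w h z).cost (initState i N L α) : ℕ∞) ≤ 2 * A.worstCaseBits N := by
  rw [flip, ← extState_initState (A.workInit n) w h hi α, Prog.cost_ext,
    ← inputState_eq, Prog.cost_conj _ _ (hf.localAct_phaseGate hz α), ← bits_eq, ← bits_eq,
    Nat.cast_add, two_mul]
  exact add_le_add (A.bits_le_worstCaseBits _) (A.bits_le_worstCaseBits _)

end Flip

end QAlgorithm

/-! ### Exact amplitude amplification -/

section Amplification

/-- A rotation of a qubit by which weight one is observed with probability `1 / 4` when it is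
applied to `n` qubits `false`. -/
theorem exists_rotation (n : ℕ) : ∃ c s : ℝ, c ^ 2 + s ^ 2 = 1 ∧
    (0 < n → n * (s ^ 2 * (c ^ 2) ^ (n - 1)) = 1 / 4) := by
  rcases n.eq_zero_or_pos with rfl | hn
  · exact ⟨1, 0, by norm_num, fun h => absurd h (lt_irrefl 0)⟩
  have hn' : (1 : ℝ) ≤ n := by exact_mod_cast hn
  have hcont : ContinuousOn (fun p : ℝ => n * (p * (1 - p) ^ (n - 1)))
      (Set.Icc 0 (1 / (2 * n))) := by fun_prop
  -- With `p = s ^ 2`, the weight-one probability vanishes at `p = 0`; at `p = 1 / (2n)` Bernoulli's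
  -- inequality bounds it below by 1/4. The intermediate value theorem then applies.
  have hb : (1 / 4 : ℝ) ≤ n * (1 / (2 * n) * (1 - 1 / (2 * n)) ^ (n - 1)) := by
    have h1 : 1 / (2 * n : ℝ) ≤ 1 := by
      rw [div_le_one (by positivity)]
      linarith
    have h2 := one_add_mul_le_pow (a := -(1 / (2 * n : ℝ))) (by linarith) (n - 1)
    rw [Nat.cast_sub hn, Nat.cast_one, ← sub_eq_add_neg] at h2
    have h3 : (1 / 2 : ℝ) ≤ 1 + (n - 1) * -(1 / (2 * n : ℝ)) := by
      have : 1 + ((n : ℝ) - 1) * -(1 / (2 * n : ℝ)) = 1 / 2 + 1 / (2 * n) := by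
        field_simp
        ring
      rw [this]
      have : 0 ≤ 1 / (2 * n : ℝ) := by positivity
      linarith
    rw [← mul_assoc, show (n : ℝ) * (1 / (2 * n)) = 1 / 2 by field_simp]
    linarith
  obtain ⟨p, ⟨hp0, hp1⟩, hp⟩ := intermediate_value_Icc (by positivity) hcont
    (show (1 / 4 : ℝ) ∈ Set.Icc _ _ from ⟨by norm_num, hb⟩)
  have hp2 : p ≤ 1 := hp1.trans (by rw [div_le_one (by positivity)]; linarith)
  refine ⟨Real.sqrt (1 - p), Real.sqrt p, ?_, fun _ => ?_⟩
  · rw [Real.sq_sqrt hp0, Real.sq_sqrt (by linarith)]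
    ring
  · rw [Real.sq_sqrt hp0, Real.sq_sqrt (by linarith)]
    exact hp

/-- The rotation `|false⟩ ↦ c |false⟩ + s |true⟩`. -/
def rotation (c s : ℝ) (h : c ^ 2 + s ^ 2 = 1) : Matrix.unitaryGroup Bool ℂ :=
  ⟨Matrix.of fun b b' => if b = b' then (c : ℂ) else if b then (s : ℂ) else -(s : ℂ), by
    have h' : (c : ℂ) ^ 2 + (s : ℂ) ^ 2 = 1 := by exact_mod_cast h
    rw [Matrix.mem_unitaryGroup_iff]
    ext a b
    cases a <;> cases b <;>
      simp [Matrix.mul_apply, Matrix.star_apply] <;> first | ring1 | linear_combination h'⟩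

variable {n : ℕ} {c s : ℝ} (h : c ^ 2 + s ^ 2 = 1)

theorem rotation_apply_false (b : Bool) :
    (rotation c s h).1 b false = if b then (s : ℂ) else (c : ℂ) := by
  cases b <;> simp [rotation]

theorem inv_rotation_apply_false (b : Bool) :
    (rotation c s h)⁻¹.1 false b = if b then (s : ℂ) else (c : ℂ) := by
  change star ((rotation c s h).1 b false) = _
  rw [rotation_apply_false]
  cases b <;> simp

theorem sum_hammingFn_one (p q : ℂ) :
    ∑ x : Fin n → Bool, (if hammingFn 1 x then ∏ v, (if x v then p else q) else 0) =
      n * (p * q ^ (n - 1)) := by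
  have hterm (x : Fin n → Bool) : (if hammingFn 1 x then ∏ v, (if x v then p else q) else 0) =
      if hammingFn 1 x then p * q ^ (n - 1) else 0 := by
    split_ifs with hx
    · have hx : (Finset.univ.filter fun v => x v = true).card = 1 := of_decide_eq_true hx
      rw [Finset.prod_ite, Finset.prod_const, Finset.prod_const, hx, pow_one,
        Finset.filter_not, Finset.card_sdiff_of_subset (Finset.filter_subset _ _), hx]
      simp
    · rfl
  simp only [hterm]
  rw [← Finset.sum_filter, Finset.sum_const, nsmul_eq_mul]
  congr 2
  have : (Finset.univ.filter fun x : Fin n → Bool => hammingFn 1 x = true).card =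
      (Finset.univ.powersetCard 1 : Finset (Finset (Fin n))).card := by
    refine Finset.card_nbij' (fun x => Finset.univ.filter fun v => x v = true)
      (fun S v => decide (v ∈ S)) ?_ ?_ ?_ ?_
    · intro x hx
      simpa [hammingFn, Finset.mem_powersetCard] using hx
    · intro S hS
      simpa [hammingFn, Finset.mem_powersetCard] using hS
    · intro x _
      simp
    · intro S _
      ext v
      simp
  rw [this]
  simp

theorem hammingFn_zero (x : Fin n → Bool) : hammingFn 0 x = true ↔ x = fun _ => false := by
  simp [hammingFn, Finset.filter_eq_empty_iff, funext_iff]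

/-- One step of amplitude amplification, from probability `1 / 4` to probability `1`. -/
theorem amplification (hn : (n : ℝ) * (s ^ 2 * (c ^ 2) ^ (n - 1)) = 1 / 4) {x : Fin n → Bool}
    (hx : (piTensor fun _ : Fin n => (rotation c s h).1).mulVec
      (signFlip (hammingFn 0) ((piTensor fun _ : Fin n => (rotation c s h)⁻¹.1).mulVec
        (signFlip (hammingFn 1) ((piTensor fun _ : Fin n => (rotation c s h).1).mulVec
          (Pi.single (fun _ => false) 1))))) x ≠ 0) : hammingFn 1 x = true := by
  set R := rotation c s h with hR
  set M := piTensor fun _ : Fin n => R.1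
  set M' := piTensor fun _ : Fin n => R⁻¹.1
  set e : (Fin n → Bool) → ℂ := Pi.single (fun _ => false) 1
  set a := M.mulVec e
  have hMM : M * M' = 1 := by
    rw [← piTensor_mul, ← piTensor_one]
    exact congrArg piTensor (funext fun _ => congrArg Subtype.val (mul_inv_cancel R))
  have hMM' : M' * M = 1 := by
    rw [← piTensor_mul, ← piTensor_one]
    exact congrArg piTensor (funext fun _ => congrArg Subtype.val (inv_mul_cancel R))
  -- The component of `a` on weight one, whose squared norm is 1/4.
  let b : (Fin n → Bool) → ℂ := fun x => if hammingFn 1 x then a x else 0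
  have ha (x : Fin n → Bool) : a x = ∏ v, if x v then (s : ℂ) else c := by
    simp only [a, e, Matrix.mulVec_single_one, Matrix.col_apply, M, piTensor_apply, hR,
      rotation_apply_false]
  have h1 : signFlip (hammingFn 1) a = a - (2 : ℂ) • b := by
    funext y
    simp only [signFlip, Pi.sub_apply, Pi.smul_apply, b, smul_eq_mul]
    split_ifs <;> ring
  have h2 : M'.mulVec (signFlip (hammingFn 1) a) = e - (2 : ℂ) • M'.mulVec b := by
    rw [h1, Matrix.mulVec_sub, Matrix.mulVec_smul, Matrix.mulVec_mulVec, hMM', Matrix.one_mulVec]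
  -- The all-false row of `R⁻¹` has the same real entries as `a`, so this coordinate is the
  -- weight-one probability.
  have hb : M'.mulVec b (fun _ => false) = 1 / 4 := by
    have : M'.mulVec b (fun _ => false) = ∑ x : Fin n → Bool, (if hammingFn 1 x then
        ∏ v, (if x v then (s : ℂ) ^ 2 else (c : ℂ) ^ 2) else 0) := by
      refine Finset.sum_congr rfl fun y _ => ?_
      simp only [M', b, piTensor_apply, hR, inv_rotation_apply_false, ha]
      split_ifs
      · rw [← Finset.prod_mul_distrib]
        refine Finset.prod_congr rfl fun v _ => ?_
        split_ifs <;> ring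
      · rw [mul_zero]
    rw [this, sum_hammingFn_one]
    have := congrArg Complex.ofReal hn
    push_cast at this
    exact this
  -- At the all-false string the value 1 - 2/4 = 1/2 becomes -1/2 = -2 · 1/4; elsewhere `e`
  -- vanishes. This is where probability 1/4 is needed exactly.
  have h3 : signFlip (hammingFn 0) (e - (2 : ℂ) • M'.mulVec b) = (-2 : ℂ) • M'.mulVec b := by
    funext y
    by_cases hy : y = fun _ => false
    · simp only [signFlip, (hammingFn_zero y).2 hy, if_true, Pi.sub_apply, Pi.smul_apply]
      rw [hy, hb]
      simp only [e, Pi.single_eq_same, smul_eq_mul]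
      norm_num
    · simp [signFlip, (hammingFn_zero y).not.2 hy, e, hy]
  rw [h2, h3, Matrix.mulVec_smul, Matrix.mulVec_mulVec, hMM, Matrix.one_mulVec] at hx
  by_contra hw
  exact hx (by simp [b, hw])

theorem existsUnique_of_hammingFn_one {x : Fin n → Bool} (hx : hammingFn 1 x = true) :
    ∃! v, x v = true := by
  obtain ⟨v, hv⟩ := Finset.card_eq_one.1 (of_decide_eq_true hx)
  have hmem (u : Fin n) : x u = true ↔ u = v := by
    simpa using Finset.ext_iff.1 hv u
  exact ⟨v, (hmem v).2 rfl, fun u hu => (hmem u).1 hu⟩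

end Amplification

/-! ### The leader election algorithm -/

section Election

variable (H₀ H₁ : QAlgorithm)

/-- The rotation of `exists_rotation`. -/
def weightOneRotation (n : ℕ) : Matrix.unitaryGroup Bool ℂ :=
  rotation (exists_rotation n).choose (exists_rotation n).choose_spec.choose
    (exists_rotation n).choose_spec.choose_spec.1

/-- An `n`-th root of `-1`. -/
def rootNegOne (n : ℕ) : unitary ℂ :=
  ⟨Complex.exp ((Real.pi / n : ℝ) * Complex.I), by
    rw [Unitary.mem_iff_self_mul_star]
    change _ * (starRingEnd ℂ) _ = 1
    rw [Complex.mul_conj, Complex.normSq_eq_norm_sq, Complex.norm_exp_ofReal_mul_I]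
    simp⟩

theorem rootNegOne_pow {n : ℕ} (hn : n ≠ 0) : (rootNegOne n : ℂ) ^ n = -1 := by
  have hn' : (n : ℂ) ≠ 0 := by exact_mod_cast hn
  rw [rootNegOne, ← Complex.exp_nat_mul, ← Complex.exp_pi_mul_I]
  congr 1
  push_cast
  field_simp

/-- The inclusion of the workspace of the first algorithm. -/
def leftWork (n d : ℕ) : H₀.Work n d ↪ H₀.Work n d × H₁.Work n d where
  toFun a := (a, H₁.workInit n d)
  inj' _ _ h := congrArg Prod.fst h

/-- The inclusion of the workspace of the second algorithm. -/
def rightWork (n d : ℕ) : H₁.Work n d ↪ H₀.Work n d × H₁.Work n d where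
  toFun a := (H₀.workInit n d, a)
  inj' _ _ h := congrArg Prod.snd h

/-- The common initial workspace of the two algorithms. -/
def electionInit (n d : ℕ) : H₀.Work n d × H₁.Work n d :=
  (H₀.workInit n d, H₁.workInit n d)

/-- Amplitude amplification of the inputs of weight one, which are then copied to the output. -/
def electionProg (n : ℕ) : Prog (fun d => H₀.Work n d × H₁.Work n d)
    (max (H₀.msgLen n) (H₁.msgLen n)) :=
  (Prog.gate (inputGate (weightOneRotation n))).andThen <|
    (H₁.flip (rightWork H₀ H₁ n) (le_max_right _ _) (rootNegOne n)).andThen <|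
      (Prog.gate (inputGate (weightOneRotation n)⁻¹)).andThen <|
        (H₀.flip (leftWork H₀ H₁ n) (le_max_left _ _) (rootNegOne n)).andThen <|
          (Prog.gate (inputGate (weightOneRotation n))).andThen (Prog.gate copyGate)

/-- Leader election by means of algorithms which compute `hammingFn 0` and `hammingFn 1`. -/
def electionAlgorithm : QAlgorithm where
  rounds n := (electionProg H₀ H₁ n).rounds
  msgLen n := max (H₀.msgLen n) (H₁.msgLen n)
  Work n d := H₀.Work n d × H₁.Work n d
  workInit := electionInit H₀ H₁
  op n := (electionProg H₀ H₁ n).op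

theorem rounds_electionAlgorithm (n : ℕ) :
    (electionAlgorithm H₀ H₁).rounds n = 2 * (H₀.rounds n + H₁.rounds n) := by
  change 0 + (2 * H₁.rounds n + (0 + (2 * H₀.rounds n + (0 + 0)))) = _
  ring

variable {H₀ H₁} {n : ℕ} {N : Network n}

/-- The amplitudes of the inputs after the amplification. -/
def amplified (n : ℕ) : (Fin n → Bool) → ℂ :=
  (piTensor fun _ : Fin n => (weightOneRotation n).1).mulVec
    (signFlip (hammingFn 0) ((piTensor fun _ : Fin n => (weightOneRotation n)⁻¹.1).mulVec
      (signFlip (hammingFn 1) ((piTensor fun _ : Fin n => (weightOneRotation n).1).mulVec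
        (Pi.single (fun _ => false) 1)))))

theorem final_electionProg (hn : n ≠ 0) (h₀ : H₀.ExactlyComputes N (hammingFn 0))
    (h₁ : H₁.ExactlyComputes N (hammingFn 1)) :
    (electionProg H₀ H₁ n).final N
        (initState (electionInit H₀ H₁ n) N _ (Pi.single (fun _ => false) 1)) =
      localAct N copyGate (initState (electionInit H₀ H₁ n) N _ (amplified n)) := by
  have hz := rootNegOne_pow hn
  rw [electionProg, Prog.final_andThen, final_inputGate, Prog.final_andThen,
    QAlgorithm.final_flip (i := electionInit H₀ H₁ n) _ _ h₁ hz (fun _ => rfl),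
    Prog.final_andThen, final_inputGate, Prog.final_andThen,
    QAlgorithm.final_flip (i := electionInit H₀ H₁ n) _ _ h₀ hz (fun _ => rfl),
    Prog.final_andThen, final_inputGate, Prog.final_gate, amplified]

theorem cost_electionProg_le (hn : n ≠ 0) (h₀ : H₀.ExactlyComputes N (hammingFn 0))
    (h₁ : H₁.ExactlyComputes N (hammingFn 1)) :
    ((electionProg H₀ H₁ n).cost
        (initState (electionInit H₀ H₁ n) N _ (Pi.single (fun _ => false) 1)) : ℕ∞) ≤
      2 * (H₀.worstCaseBits N + H₁.worstCaseBits N) := by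
  have hz := rootNegOne_pow hn
  rw [electionProg, Prog.cost_andThen, Prog.cost_gate, final_inputGate, Prog.cost_andThen,
    QAlgorithm.final_flip (i := electionInit H₀ H₁ n) _ _ h₁ hz (fun _ => rfl),
    Prog.cost_andThen, Prog.cost_gate, final_inputGate, Prog.cost_andThen, Prog.cost_andThen,
    Prog.cost_gate, Prog.cost_gate, zero_add, zero_add, add_zero, add_zero, Nat.cast_add, mul_add,
    add_comm]
  exact add_le_add (QAlgorithm.cost_flip_le _ _ h₀ hz (fun _ => rfl) _)
    (QAlgorithm.cost_flip_le _ _ h₁ hz (fun _ => rfl) _)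

theorem electsLeader_electionAlgorithm (h₀ : H₀.ExactlyComputes N (hammingFn 0))
    (h₁ : H₁.ExactlyComputes N (hammingFn 1)) :
    (electionAlgorithm H₀ H₁).ExactlyElectsLeader N := by
  -- A connected graph has a vertex; both the root of -1 and the rotation need `n` positive.
  have hn : 0 < n := Fin.pos_iff_nonempty.2 N.connected.nonempty
  intro c hc
  rw [QAlgorithm.finalState_eq] at hc
  obtain ⟨x, hx, hout⟩ := outBit_eq_of_copyGate (electionInit H₀ H₁ n)
    ((congrFun (final_electionProg hn.ne' h₀ h₁) c).symm.trans_ne hc)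
  obtain ⟨v, hv, huniq⟩ := existsUnique_of_hammingFn_one
    (amplification _ ((exists_rotation n).choose_spec.choose_spec.2 hn) hx)
  exact ⟨v, (hout v).trans hv, fun u hu => huniq u ((hout u).symm.trans hu)⟩

theorem bitsNoInput_electionAlgorithm_le (h₀ : H₀.ExactlyComputes N (hammingFn 0))
    (h₁ : H₁.ExactlyComputes N (hammingFn 1)) :
    ((electionAlgorithm H₀ H₁).bitsNoInput N : ℕ∞) ≤
      2 * (H₀.worstCaseBits N + H₁.worstCaseBits N) := by
  have hn : 0 < n := Fin.pos_iff_nonempty.2 N.connected.nonempty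
  rw [QAlgorithm.bitsNoInput, QAlgorithm.bits_eq]
  exact cost_electionProg_le hn.ne' h₀ h₁

end Election

end AnonymousQuantumNetwork

end

theorem theorem1 :
    ∃ C : ℕ, ∀ H₀ H₁ : AnonymousQuantumNetwork.QAlgorithm,
      ∃ B : AnonymousQuantumNetwork.QAlgorithm,
        ∀ (n : ℕ) (N : AnonymousQuantumNetwork.Network n),
          H₀.ExactlyComputes N (AnonymousQuantumNetwork.hammingFn 0) →
          H₁.ExactlyComputes N (AnonymousQuantumNetwork.hammingFn 1) →
            B.ExactlyElectsLeader N ∧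
            B.rounds n ≤ C * (H₀.rounds n + H₁.rounds n) ∧
            (B.bitsNoInput N : ℕ∞) ≤ C * (H₀.worstCaseBits N + H₁.worstCaseBits N) := by
  -- Each of `H₀` and `H₁` runs once forwards and once backwards.
  refine ⟨2, fun H₀ H₁ => ⟨AnonymousQuantumNetwork.electionAlgorithm H₀ H₁,
    fun n N h₀ h₁ => ⟨AnonymousQuantumNetwork.electsLeader_electionAlgorithm h₀ h₁, ?_, ?_⟩⟩⟩
  · exact (AnonymousQuantumNetwork.rounds_electionAlgorithm H₀ H₁ n).le
  · exact AnonymousQuantumNetwork.bitsNoInput_electionAlgorithm_le h₀ h₁
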